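/- Let $C([0,1])$ be the Banach space of real continuous functions on $[0,1]$ with the supremum norm, and let $\mathcal{SE}(C([0,1]))$ be the set of all closed linear subspaces of $C([0,1])$, equipped with the $\sigma$-algebra induced by the Effros Borel structure, i.e. generated by the sets $\{X : X\cap U\neq\emptyset\}$ with $U\subset C([0,1])$ open. A subset $A$ of a standard Borel space $S$ is called $\mathbf{\Sigma}^1_1$ if it is the projection on $S$ of a Borel subset of $S\times Y$ for some standard Borel space $Y$; $\mathbf{\Pi}^1_1$ sets are the complements of $\mathbf{\Sigma}^1_1$ sets; $A$ is $\mathbf{\Sigma}^1_2$ if it is the projection on $S$ of a $\mathbf{\Pi}^1_1$ subset of $S\times Y$ for some standard Borel space $Y$; $\mathbf{\Pi}^1_2$ sets are the complements of $\mathbf{\Sigma}^1_2$ sets. A bounded linear operator between Banach spaces is weakly compact if the image of the closed unit ball is relatively weakly compact, and completely continuous if it maps weakly convergent sequences to norm convergent ones. A Banach space $X$ has the Dunford–Pettis property if every weakly compact operator from $X$ into any Banach space is completely continuous. Then the following hold. (1) The set of all $X\in\mathcal{SE}(C([0,1]))$ with the Dunford–Pettis property is a $\mathbf{\Pi}^1_2$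 subset of $\mathcal{SE}(C([0,1]))$. (2) Write $B_Z$ for the closed unit ball of a Banach space $Z$. A space $X\in\mathcal{SE}(C([0,1]))$ has the Dunford–Pettis property if and only if for all sequences $(x_n)_{n\ge1}$ in $B_{C([0,1])}$ and $(y_n)_{n\ge1}$ in $B_{c_0}$ at least one of the following is satisfied: (a) $B_X\neq\overline{\{x_1,x_2,\dots\}}$; (b) there is no bounded linear operator $T:\overline{\mathrm{span}}\{x_1,x_2,\dots\}\to c_0$ with $Tx_n=y_n$ for all $n$; (c) $\{y_1,y_2,\dots\}$ is not relatively weakly compact in $c_0$; (d) the sequence $x_2,x_4,x_6,\dots$ is not weakly null; (e) the sequence $y_2,y_4,y_6,\dots$ converges to $0$ in norm. -/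

import Mathlib

open Set Filter Topology TopologicalSpace
open scoped ZeroAtInfty

universe u

/-- A subset `A` of `X` is `Σ¹₁` (analytic) if it is the projection of a measurable subset of
`X × Y` for some standard Borel space `Y`. -/
def IsSigma11 {X : Type u} [MeasurableSpace X] (A : Set X) : Prop :=
  ∃ (Y : Type) (_ : MeasurableSpace Y) (_ : StandardBorelSpace Y) (B : Set (X × Y)),
    MeasurableSet B ∧ A = Prod.fst '' B

/-- `Π¹₁` (coanalytic) sets: complements of `Σ¹₁` sets. -/
def IsPi11 {X : Type u} [MeasurableSpace X] (A : Set X) : Prop :=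
  IsSigma11 Aᶜ

/-- `A` is `Σ¹₂` if it is the projection of a `Π¹₁` subset of `X × Y` for some standard Borel
space `Y`. -/
def IsSigma12 {X : Type u} [MeasurableSpace X] (A : Set X) : Prop :=
  ∃ (Y : Type) (_ : MeasurableSpace Y) (_ : StandardBorelSpace Y) (B : Set (X × Y)),
    IsPi11 B ∧ A = Prod.fst '' B

/-- `Π¹₂` sets: complements of `Σ¹₂` sets. -/
def IsPi12 {X : Type u} [MeasurableSpace X] (A : Set X) : Prop :=
  IsSigma12 Aᶜ

/-- The Effros Borel structure on the set of all closed subsets of a topological space: the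
`σ`-algebra generated by the sets `{F | F ∩ U ≠ ∅}` with `U` open. -/
def effrosBorel (X : Type u) [TopologicalSpace X] : MeasurableSpace (Closeds X) :=
  MeasurableSpace.generateFrom
    {S | ∃ U : Set X, IsOpen U ∧ S = {F : Closeds X | ((F : Set X) ∩ U).Nonempty}}

/-- The real Banach space `C([0, 1])` with the supremum norm. -/
abbrev CUnit : Type := C(unitInterval, ℝ)

/-- `SE(C([0, 1]))`: the closed linear subspaces of `C([0, 1])`. -/
abbrev SE : Type := ClosedSubmodule ℝ CUnit

/-- `SE(C([0, 1]))` carries the `σ`-algebra induced from the Effros Borel structure on the closed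
subsets of `C([0, 1])`. -/
instance SE.instMeasurableSpace : MeasurableSpace SE :=
  MeasurableSpace.comap ClosedSubmodule.toCloseds (effrosBorel CUnit)

/-- The sequence `x` in the real normed space `E` converges weakly to `a`. -/
def WeaklyTendsto {E : Type u} [NormedAddCommGroup E] [NormedSpace ℝ E] (x : ℕ → E) (a : E) :
    Prop :=
  Tendsto (fun n => toWeakSpace ℝ E (x n)) atTop (𝓝 (toWeakSpace ℝ E a))

/-- The set `S` is relatively weakly compact: its weak closure is weakly compact. -/
def IsRelativelyWeaklyCompact {E : Type u} [NormedAddCommGroup E] [NormedSpace ℝ E] (S : Set E) :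
    Prop :=
  IsCompact (closure (toWeakSpace ℝ E '' S))

/-- An operator is weakly compact if the image of the closed unit ball is relatively weakly
compact. -/
def IsWeaklyCompactOperator {X Y : Type u} [NormedAddCommGroup X] [NormedSpace ℝ X]
    [NormedAddCommGroup Y] [NormedSpace ℝ Y] (T : X →L[ℝ] Y) : Prop :=
  IsRelativelyWeaklyCompact (T '' Metric.closedBall (0 : X) 1)

/-- An operator is completely continuous if it maps weakly convergent sequences to norm convergent
ones. -/
def IsCompletelyContinuous {X Y : Type u} [NormedAddCommGroup X] [NormedSpace ℝ X]
    [NormedAddCommGroup Y] [NormedSpace ℝ Y] (T : X →L[ℝ] Y) : Prop :=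
  ∀ (x : ℕ → X) (a : X), WeaklyTendsto x a → ∃ b : Y, Tendsto (fun n => T (x n)) atTop (𝓝 b)

/-- The Dunford–Pettis property: every weakly compact operator into a Banach space is completely
continuous. -/
def HasDunfordPettis (X : Type u) [NormedAddCommGroup X] [NormedSpace ℝ X] : Prop :=
  ∀ (Y : Type u) [NormedAddCommGroup Y] [NormedSpace ℝ Y] [CompleteSpace Y] (T : X →L[ℝ] Y),
    IsWeaklyCompactOperator T → IsCompletelyContinuous T

/-- The closed linear span of the terms of a sequence in `C([0, 1])`. -/
abbrev closedSpan (x : ℕ → CUnit) : Submodule ℝ CUnit :=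
  (Submodule.span ℝ (range x)).topologicalClosure

theorem mem_closedSpan (x : ℕ → CUnit) (n : ℕ) : x n ∈ closedSpan x :=
  Submodule.le_topologicalClosure _ (Submodule.subset_span (mem_range_self n))

/-- The assignment `x n ↦ y n` defines a bounded linear operator from the closed linear span of
the `x n` into `c₀`. -/
def DefinesBoundedOperator (x : ℕ → CUnit) (y : ℕ → C₀(ℕ, ℝ)) : Prop :=
  ∃ T : closedSpan x →L[ℝ] C₀(ℕ, ℝ), ∀ n, T ⟨x n, mem_closedSpan x n⟩ = y n

/-- The condition on a closed subspace `X` of `C([0, 1])` in terms of all sequences `x` in the unit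
ball of `C([0, 1])` and `y` in the unit ball of `c₀`. A sequence `x₁, x₂, …` is indexed here
as `x 0, x 1, …`, so that its even-indexed terms `x₂, x₄, …` are the `x (2 * k + 1)`. -/
def SequenceCondition (X : SE) : Prop :=
  ∀ x : ℕ → CUnit, (∀ n, x n ∈ Metric.closedBall (0 : CUnit) 1) →
  ∀ y : ℕ → C₀(ℕ, ℝ), (∀ n, y n ∈ Metric.closedBall (0 : C₀(ℕ, ℝ)) 1) →
    (X : Set CUnit) ∩ Metric.closedBall (0 : CUnit) 1 ≠ closure (range x) ∨
    ¬ DefinesBoundedOperator x y ∨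
    ¬ IsRelativelyWeaklyCompact (range y) ∨
    ¬ WeaklyTendsto (fun k => x (2 * k + 1)) 0 ∨
    Tendsto (fun k => y (2 * k + 1)) atTop (𝓝 0)

/-!
A space fails the Dunford–Pettis property exactly when some weakly compact operator into `c₀` does
not tend to zero along some weakly null sequence. To see this, let `T : X → Y` be weakly compact and
bounded below in norm along a weakly null sequence `u`, with `X` separable. Choose norm-one
functionals `g n` on the closure of the range of `T` that attain the norm of `T (u n)`, and a
weak-* convergent subsequence with limit `b`. Then `z ↦ (g n z - b z)` is an operator into `c₀`, and
its composition with `T` is still weakly compact and bounded below along a subsequence of `u`, as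
`b (T (u n))` tends to zero (`exists_weaklyCompact_operator_czero`). Interlacing `u`, suitably
scaled, with a dense sequence of the unit ball of `X` gives the sequences in the criterion.
Conversely, if the `x n` are dense in the unit ball of `X`, the closure of the `y n` contains the
image of that ball, so that the operator is weakly compact as soon as the `y n` form a relatively
weakly compact set.

For the complexity, the failure of the criterion is a projection along the pairs `(x, y)`, which
range over a Polish space. All conditions but two are Borel in `(X, x, y)`: the existence of the
operator amounts to countably many inequalities (`exists_clm_closure_span_iff`), and membership in
`X` and density in its unit ball are tested on open sets. The other two are universal quantifications
of Borel conditions over real sequences `z`, hence `Π¹₁`: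

* weak nullity in `C([0, 1])` is, by the Hahn–Banach theorem, tested on the sequences `z` of values
  on `x` of functionals on the closed span of `x` (`weaklyTendsto_comp_zero_iff`);
* a bounded subset of `c₀` is relatively weakly compact if and only if every `z` in its
  coordinatewise closure is a null sequence (`CZero.isRelativelyWeaklyCompact_iff`).
-/

/-! ### Weak topologies and relative weak compactness -/

section WeakTopology

variable {E : Type*} [NormedAddCommGroup E] [NormedSpace ℝ E]

theorem tendsto_toWeakSpace_iff {ι : Type*} {l : Filter ι} {x : ι → E} {a : E} :
    Tendsto (fun i => toWeakSpace ℝ E (x i)) l (𝓝 (toWeakSpace ℝ E a)) ↔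
      ∀ f : StrongDual ℝ E, Tendsto (fun i => f (x i)) l (𝓝 (f a)) := by
  refine WeakBilin.tendsto_iff_forall_eval_tendsto (B := (topDualPairing ℝ E).flip) ?_
  intro a b hab
  refine (SeparatingDual.eq_iff_forall_dual_eq (R := ℝ)).2 fun f => ?_
  exact DFunLike.congr_fun hab f

theorem WeaklyTendsto.map {E F : Type u} [NormedAddCommGroup E] [NormedSpace ℝ E]
    [NormedAddCommGroup F] [NormedSpace ℝ F] {x : ℕ → E} {a : E} (h : WeaklyTendsto x a)
    (T : E →L[ℝ] F) : WeaklyTendsto (fun n => T (x n)) (T a) :=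
  tendsto_toWeakSpace_iff.2 fun f => tendsto_toWeakSpace_iff.1 h (f.comp T)

theorem WeaklyTendsto.comp {E : Type u} [NormedAddCommGroup E] [NormedSpace ℝ E] {x : ℕ → E} {a : E}
    (h : WeaklyTendsto x a) {φ : ℕ → ℕ} (hφ : Tendsto φ atTop atTop) :
    WeaklyTendsto (fun n => x (φ n)) a :=
  Filter.Tendsto.comp (f := φ) (g := fun n => toWeakSpace ℝ E (x n)) h hφ

/-- Weakly convergent sequences are bounded, by the uniform boundedness principle on the dual. -/
theorem WeaklyTendsto.exists_norm_le {E : Type u} [NormedAddCommGroup E] [NormedSpace ℝ E]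
    {x : ℕ → E} {a : E} (h : WeaklyTendsto x a) : ∃ C, ∀ n, ‖x n‖ ≤ C := by
  obtain ⟨C, hC⟩ := banach_steinhaus
    (g := fun n => NormedSpace.inclusionInDoubleDual ℝ E (x n)) fun f => by
      obtain ⟨C, hC⟩ := (Metric.isBounded_range_of_tendsto _
        (tendsto_toWeakSpace_iff.1 h f)).exists_norm_le
      exact ⟨C, fun n => hC _ (mem_range_self n)⟩
  refine ⟨C, fun n => ?_⟩
  rw [← (NormedSpace.inclusionInDoubleDualLi (𝕜 := ℝ) (E := E)).norm_map]
  exact hC n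

/-- By the Hahn–Banach theorem, the weak topology of a subspace is the restriction of the weak
topology of the ambient space. -/
theorem isInducing_weakSpace_map_subtypeL (p : Submodule ℝ E) :
    IsInducing (WeakSpace.map (𝕜 := ℝ) p.subtypeL) := by
  refine isInducing_iff_nhds.2 fun a => le_antisymm
    ((WeakSpace.map (𝕜 := ℝ) p.subtypeL).continuous.tendsto a).le_comap ?_
  have key : Tendsto (fun b : WeakSpace ℝ p => toWeakSpace ℝ p b)
      (comap (WeakSpace.map (𝕜 := ℝ) p.subtypeL) (𝓝 (WeakSpace.map (𝕜 := ℝ) p.subtypeL a)))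
      (𝓝 (toWeakSpace ℝ p a)) := by
    refine tendsto_toWeakSpace_iff.2 fun f => ?_
    obtain ⟨g, hg, -⟩ := exists_extension_norm_eq p f
    have h := (tendsto_toWeakSpace_iff (l := comap (WeakSpace.map (𝕜 := ℝ) p.subtypeL)
      (𝓝 (WeakSpace.map (𝕜 := ℝ) p.subtypeL a)))
      (x := fun b : WeakSpace ℝ p => p.subtype ((toWeakSpace ℝ p).symm b))
      (a := p.subtype ((toWeakSpace ℝ p).symm a))).1 tendsto_comap g
    simp only [Submodule.subtype_apply, hg] at h
    exact h
  exact tendsto_id'.1 key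

theorem isRelativelyWeaklyCompact_of_subset {E : Type u} [NormedAddCommGroup E] [NormedSpace ℝ E]
    {S : Set E} {K : Set (WeakSpace ℝ E)} (hK : IsCompact K) (hK' : IsClosed K)
    (h : toWeakSpace ℝ E '' S ⊆ K) : IsRelativelyWeaklyCompact S :=
  hK.of_isClosed_subset isClosed_closure (closure_minimal h hK')

instance : T2Space (WeakSpace ℝ E) := by
  refine ⟨fun a b hab => ?_⟩
  obtain ⟨f, hf⟩ : ∃ f : StrongDual ℝ E, f a ≠ f b := by
    by_contra! h
    exact hab ((SeparatingDual.eq_iff_forall_dual_eq (R := ℝ) (V := E)).2 h)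
  exact separated_by_continuous (WeakBilin.eval_continuous (topDualPairing ℝ E).flip f) hf

end WeakTopology

section RelativeWeakCompactness

variable {E F : Type u} [NormedAddCommGroup E] [NormedSpace ℝ E]
  [NormedAddCommGroup F] [NormedSpace ℝ F]

theorem IsRelativelyWeaklyCompact.mono {S S' : Set E} (hS : IsRelativelyWeaklyCompact S)
    (h : S' ⊆ S) : IsRelativelyWeaklyCompact S' :=
  isRelativelyWeaklyCompact_of_subset hS isClosed_closure
    ((image_mono h).trans subset_closure)

theorem IsRelativelyWeaklyCompact.closure {S : Set E} (hS : IsRelativelyWeaklyCompact S) :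
    IsRelativelyWeaklyCompact (closure S) :=
  isRelativelyWeaklyCompact_of_subset hS isClosed_closure
    (image_closure_subset_closure_image (toWeakSpaceCLM ℝ E).continuous)

theorem IsRelativelyWeaklyCompact.image {S : Set E} (hS : IsRelativelyWeaklyCompact S)
    (T : E →L[ℝ] F) : IsRelativelyWeaklyCompact (T '' S) := by
  have h := IsCompact.image hS (WeakSpace.map (𝕜 := ℝ) T).continuous
  refine isRelativelyWeaklyCompact_of_subset h h.isClosed ?_
  rintro _ ⟨_, ⟨x, hx, rfl⟩, rfl⟩
  exact ⟨toWeakSpace ℝ E x, subset_closure (mem_image_of_mem _ hx), rfl⟩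

/-- Relative weak compactness descends to closed subspaces, because these are weakly closed. -/
theorem IsRelativelyWeaklyCompact.of_image_subtype {p : Submodule ℝ E} (hp : IsClosed (p : Set E))
    {S : Set p} (hS : IsRelativelyWeaklyCompact (p.subtypeL '' S)) :
    IsRelativelyWeaklyCompact S := by
  have hrange : IsClosed (range (WeakSpace.map (𝕜 := ℝ) p.subtypeL)) := by
    have h : range (WeakSpace.map (𝕜 := ℝ) p.subtypeL) = toWeakSpace ℝ E '' (p : Set E) := by
      ext x
      exact ⟨fun ⟨y, hy⟩ => ⟨_, (y : p).2, hy⟩, fun ⟨y, hy, hyx⟩ => ⟨(⟨y, hy⟩ : p), hyx⟩⟩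
    have h' := p.convex.toWeakSpace_closure ℝ
    rw [hp.closure_eq] at h'
    rw [h, h']
    exact isClosed_closure
  have h := (IsInducing.isCompact_preimage (isInducing_weakSpace_map_subtypeL p) hrange hS)
  refine isRelativelyWeaklyCompact_of_subset h
    (isClosed_closure.preimage (WeakSpace.map (𝕜 := ℝ) p.subtypeL).continuous) ?_
  rintro _ ⟨x, hx, rfl⟩
  exact subset_closure ⟨_, ⟨x, hx, rfl⟩, rfl⟩

end RelativeWeakCompactness

/-! ### Operators prescribed on a sequence -/

section Sequences

variable {E F : Type*} [NormedAddCommGroup E] [NormedSpace ℝ E]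
  [NormedAddCommGroup F] [NormedSpace ℝ F]

/-- A bounded operator with `T (x n) = y n` on the closed linear span of `x` exists if and only if
the finite rational combinations of the `y n` are bounded by those of the `x n`. Only countably many
inequalities occur, which makes the condition Borel in `(x, y)`. -/
theorem exists_clm_closure_span_iff [CompleteSpace F] (x : ℕ → E) (y : ℕ → F)
    (hx : ∀ n, x n ∈ (Submodule.span ℝ (range x)).topologicalClosure) :
    (∃ T : (Submodule.span ℝ (range x)).topologicalClosure →L[ℝ] F, ∀ n, T ⟨x n, hx n⟩ = y n) ↔
      ∃ K : ℕ, ∀ (s : Finset ℕ) (c : s → ℚ),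
        ‖∑ i, (c i : ℝ) • y i‖ ≤ K * ‖∑ i, (c i : ℝ) • x i‖ := by
  constructor
  · rintro ⟨T, hT⟩
    obtain ⟨K, hK⟩ := exists_nat_ge ‖T‖
    refine ⟨K, fun s c => ?_⟩
    have h := T.le_opNorm (∑ i, (c i : ℝ) • ⟨x i, hx i⟩)
    simp only [map_sum, map_smul, hT] at h
    rw [Submodule.coe_norm, Submodule.coe_sum] at h
    exact h.trans (mul_le_mul_of_nonneg_right hK (norm_nonneg _))
  · rintro ⟨K, hK⟩
    have hreal (s : Finset ℕ) (c : s → ℝ) : ‖∑ i, c i • y i‖ ≤ K * ‖∑ i, c i • x i‖ := by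
      have hd : DenseRange (Pi.map fun (_ : s) (q : ℚ) => (q : ℝ)) :=
        DenseRange.piMap fun _ => Rat.denseRange_cast
      exact hd.induction_on (p := fun c : s → ℝ => ‖∑ i, c i • y i‖ ≤ K * ‖∑ i, c i • x i‖) c
        (isClosed_le (by fun_prop) (by fun_prop)) (hK s)
    let e : (ℕ →₀ ℝ) →ₗ[ℝ] (Submodule.span ℝ (range x)).topologicalClosure :=
      Finsupp.linearCombination ℝ fun n => ⟨x n, hx n⟩
    have he (c : ℕ →₀ ℝ) : (e c : E) = Finsupp.linearCombination ℝ x c := by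
      simp [e, Finsupp.linearCombination_apply, Finsupp.sum]
    have hdense : DenseRange e := fun z => by
      rw [closure_subtype, ← range_comp]
      have h : range (Subtype.val ∘ e) = (Submodule.span ℝ (range x) : Set E) := by
        rw [show Subtype.val ∘ e = Finsupp.linearCombination ℝ x from funext he,
          ← LinearMap.coe_range, Finsupp.range_linearCombination]
      rw [h]
      exact z.2
    have hnorm (c : ℕ →₀ ℝ) : ‖Finsupp.linearCombination ℝ y c‖ ≤ K * ‖e c‖ := by
      rw [Submodule.coe_norm, he, Finsupp.linearCombination_apply, Finsupp.linearCombination_apply,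
        Finsupp.sum, Finsupp.sum, ← Finset.sum_coe_sort c.support fun i => c i • y i,
        ← Finset.sum_coe_sort c.support fun i => c i • x i]
      exact hreal c.support fun i => c i
    refine ⟨(Finsupp.linearCombination ℝ y).extendOfNorm e, fun n => ?_⟩
    simpa [e] using LinearMap.extendOfNorm_eq hdense ⟨K, hnorm⟩ (Finsupp.single n 1)

end Sequences

/-! ### The space `c₀` -/

namespace CZero

theorem tendsto_zero (w : C₀(ℕ, ℝ)) : Tendsto w atTop (𝓝 0) := by
  simpa using w.zero_at_infty'

/-- A null sequence of real numbers as an element of `c₀`. -/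
def ofTendsto (z : ℕ → ℝ) (hz : Tendsto z atTop (𝓝 0)) : C₀(ℕ, ℝ) where
  toFun := z
  continuous_toFun := continuous_of_discreteTopology
  zero_at_infty' := by simpa using hz

@[simp]
theorem ofTendsto_apply (z : ℕ → ℝ) (hz : Tendsto z atTop (𝓝 0)) (i : ℕ) :
    ofTendsto z hz i = z i := rfl

theorem norm_le_iff {w : C₀(ℕ, ℝ)} {r : ℝ} (hr : 0 ≤ r) : ‖w‖ ≤ r ↔ ∀ i, |w i| ≤ r := by
  rw [← ZeroAtInftyContinuousMap.norm_toBCF_eq_norm, BoundedContinuousFunction.norm_le hr]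
  rfl

theorem abs_apply_le_norm (w : C₀(ℕ, ℝ)) (i : ℕ) : |w i| ≤ ‖w‖ :=
  (norm_le_iff (norm_nonneg w)).1 le_rfl i

/-- The `i`-th coordinate functional on `c₀`. -/
noncomputable def coord (i : ℕ) : StrongDual ℝ C₀(ℕ, ℝ) :=
  LinearMap.mkContinuous
    { toFun := fun w => w i
      map_add' := fun _ _ => rfl
      map_smul' := fun _ _ => rfl } 1 fun w => by simpa using abs_apply_le_norm w i

@[simp]
theorem coord_apply (i : ℕ) (w : C₀(ℕ, ℝ)) : coord i w = w i := rfl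

theorem continuous_coe : Continuous fun (w : C₀(ℕ, ℝ)) (i : ℕ) => w i :=
  continuous_pi fun i => (coord i).continuous

/-- The `i`-th unit vector of `c₀`. -/
def unitVec (i : ℕ) : C₀(ℕ, ℝ) :=
  ofTendsto (Pi.single i 1) <| tendsto_const_nhds.congr' <|
    (eventually_gt_atTop i).mono fun _ hj =>
      (Pi.single_eq_of_ne (M := fun _ => ℝ) hj.ne' 1).symm

theorem sum_smul_unitVec_apply (s : Finset ℕ) (c : ℕ → ℝ) (j : ℕ) :
    (∑ i ∈ s, c i • unitVec i) j = if j ∈ s then c j else 0 := by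
  rw [← coord_apply, map_sum]
  simp [unitVec, Pi.single_apply]

theorem hasSum_smul_unitVec (w : C₀(ℕ, ℝ)) : HasSum (fun i => w i • unitVec i) w := by
  refine Metric.tendsto_nhds.2 fun ε hε => ?_
  obtain ⟨N, hN⟩ := eventually_atTop.1
    (Metric.tendsto_nhds.1 (tendsto_zero w) (ε / 2) (half_pos hε))
  filter_upwards [eventually_ge_atTop (Finset.range N)] with s hs
  rw [dist_comm, dist_eq_norm]
  refine lt_of_le_of_lt ((norm_le_iff (half_pos hε).le).2 fun j => ?_) (half_lt_self hε)
  rw [ZeroAtInftyContinuousMap.sub_apply, sum_smul_unitVec_apply]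
  split_ifs with hj
  · simpa using (half_pos hε).le
  · have h := hN j (by by_contra! h; exact hj (hs (Finset.mem_range.2 h)))
    simpa [Real.dist_eq] using h.le

/-- A functional on `c₀` takes absolutely summable values on the unit vectors: test it on the finite
sums of unit vectors with signs `±1`, which have norm at most one. -/
theorem summable_abs_apply_unitVec (f : StrongDual ℝ C₀(ℕ, ℝ)) :
    Summable fun i => |f (unitVec i)| := by
  refine summable_of_sum_le (c := ‖f‖) (fun i => abs_nonneg _) fun s => ?_
  have h : ∑ i ∈ s, |f (unitVec i)| =
      f (∑ i ∈ s, (SignType.sign (f (unitVec i)) : ℝ) • unitVec i) := by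
    simp [sign_mul_self]
  rw [h]
  refine (le_abs_self _).trans (f.le_of_opNorm_le_of_le le_rfl
    ((norm_le_iff zero_le_one).2 fun j => ?_) |>.trans_eq (mul_one _))
  rw [sum_smul_unitVec_apply]
  split_ifs
  · cases SignType.sign (f (unitVec j)) <;> simp
  · simp

instance : SeparableSpace C₀(ℕ, ℝ) := by
  have h : Dense (Submodule.span ℝ (range unitVec) : Set C₀(ℕ, ℝ)) := fun w =>
    mem_closure_of_tendsto (hasSum_smul_unitVec w) <| Eventually.of_forall fun s =>
      Submodule.sum_mem _ fun i _ => Submodule.smul_mem _ _ (Submodule.subset_span ⟨i, rfl⟩)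
  have h' := (isSeparable_range (continuous_of_discreteTopology (f := unitVec))).span (R := ℝ)
  rw [← isSeparable_univ_iff, ← h.closure_eq]
  exact h'.closure

/-- On a bounded set, weak convergence in `c₀` is coordinatewise convergence. -/
theorem continuous_apply_of_bounded {α : Type*} [TopologicalSpace α] {g : α → C₀(ℕ, ℝ)} {R : ℝ}
    (hR : ∀ a, ‖g a‖ ≤ R) (hg : ∀ i, Continuous fun a => g a i) (f : StrongDual ℝ C₀(ℕ, ℝ)) :
    Continuous fun a => f (g a) := by
  have h (a : α) : f (g a) = ∑' i, g a i * f (unitVec i) := by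
    simpa using (((hasSum_smul_unitVec (g a)).mapL f).tsum_eq).symm
  simp only [h]
  refine continuous_tsum (fun i => (hg i).mul continuous_const)
    ((summable_abs_apply_unitVec f).mul_left R) fun i a => ?_
  rw [Real.norm_eq_abs, abs_mul]
  exact mul_le_mul_of_nonneg_right ((abs_apply_le_norm _ _).trans (hR a)) (abs_nonneg _)

/-- A bounded subset of `c₀` is relatively weakly compact if and only if its closure in the product
`ℝ^ℕ` consists of null sequences. By Tychonoff's theorem that closure is always compact, and if it
lies in `c₀` it carries the weak topology. -/
theorem isRelativelyWeaklyCompact_iff {S : Set C₀(ℕ, ℝ)} {R : ℝ} (hS : ∀ w ∈ S, ‖w‖ ≤ R) :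
    IsRelativelyWeaklyCompact S ↔
      ∀ z ∈ closure ((fun (w : C₀(ℕ, ℝ)) (i : ℕ) => w i) '' S), Tendsto z atTop (𝓝 0) := by
  constructor
  · intro h z hz
    have hc : Continuous fun (w : WeakSpace ℝ C₀(ℕ, ℝ)) (i : ℕ) => coord i w :=
      continuous_pi fun i => WeakBilin.eval_continuous (topDualPairing ℝ C₀(ℕ, ℝ)).flip (coord i)
    have hK := IsCompact.image h hc
    obtain ⟨w, -, rfl⟩ := closure_minimal (by
      rintro _ ⟨w, hw, rfl⟩
      exact ⟨toWeakSpace ℝ _ w, subset_closure (mem_image_of_mem _ hw), rfl⟩) hK.isClosed hz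
    exact tendsto_zero w
  · intro h
    set A := closure ((fun (w : C₀(ℕ, ℝ)) (i : ℕ) => w i) '' S)
    have hAsub : A ⊆ Set.univ.pi fun _ => Metric.closedBall (0 : ℝ) R := by
      refine closure_minimal ?_ (isClosed_set_pi fun _ _ => Metric.isClosed_closedBall)
      rintro _ ⟨w, hw, rfl⟩ i -
      simpa using (abs_apply_le_norm w i).trans (hS w hw)
    have hAcomp : IsCompact A :=
      (isCompact_univ_pi fun _ => isCompact_closedBall _ _).of_isClosed_subset isClosed_closure hAsub
    have : CompactSpace A := isCompact_iff_compactSpace.1 hAcomp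
    let g : A → C₀(ℕ, ℝ) := fun z => ofTendsto z.1 (h z.1 z.2)
    have hg (a : A) : ‖g a‖ ≤ R := by
      have h1 (i : ℕ) : |g a i| ≤ R := by simpa [g] using hAsub a.2 i (mem_univ i)
      exact (norm_le_iff ((abs_nonneg _).trans (h1 0))).2 h1
    have hgc : Continuous fun a => toWeakSpace ℝ C₀(ℕ, ℝ) (g a) :=
      WeakBilin.continuous_of_continuous_eval _ fun f =>
        continuous_apply_of_bounded hg (fun i => (continuous_apply i).comp continuous_subtype_val) f
    refine isRelativelyWeaklyCompact_of_subset (isCompact_range hgc) (isCompact_range hgc).isClosed ?_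
    rintro _ ⟨w, hw, rfl⟩
    exact ⟨⟨_, subset_closure (mem_image_of_mem _ hw)⟩, rfl⟩

/-- A pointwise null, uniformly bounded sequence of functionals defines an operator into `c₀`. -/
noncomputable def ofFunctionals {E : Type*} [NormedAddCommGroup E] [NormedSpace ℝ E]
    (φ : ℕ → StrongDual ℝ E) {C : ℝ} (hC : ∀ k, ‖φ k‖ ≤ C)
    (hφ : ∀ x, Tendsto (fun k => φ k x) atTop (𝓝 0)) : E →L[ℝ] C₀(ℕ, ℝ) :=
  LinearMap.mkContinuous
    { toFun := fun x => ofTendsto (fun k => φ k x) (hφ x)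
      map_add' := fun x y => by ext k; simp
      map_smul' := fun c x => by ext k; simp } C fun x => by
    refine (norm_le_iff (mul_nonneg ((norm_nonneg _).trans (hC 0)) (norm_nonneg x))).2 fun k => ?_
    exact (φ k).le_of_opNorm_le (hC k) x

@[simp]
theorem ofFunctionals_apply {E : Type*} [NormedAddCommGroup E] [NormedSpace ℝ E]
    (φ : ℕ → StrongDual ℝ E) {C : ℝ} (hC : ∀ k, ‖φ k‖ ≤ C)
    (hφ : ∀ x, Tendsto (fun k => φ k x) atTop (𝓝 0)) (x : E) (k : ℕ) :
    ofFunctionals φ hC hφ x k = φ k x := rfl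

end CZero

/-! ### The Dunford–Pettis property through operators into `c₀` -/

section DunfordPettis

theorem IsWeaklyCompactOperator.clm_comp {X Y Z : Type u} [NormedAddCommGroup X] [NormedSpace ℝ X]
    [NormedAddCommGroup Y] [NormedSpace ℝ Y] [NormedAddCommGroup Z] [NormedSpace ℝ Z]
    {T : X →L[ℝ] Y} (hT : IsWeaklyCompactOperator T) (R : Y →L[ℝ] Z) :
    IsWeaklyCompactOperator (R.comp T) := by
  have h := IsRelativelyWeaklyCompact.image hT R
  rw [← image_comp] at h
  exact h

/-- If a weakly compact operator is bounded below on a weakly null sequence `u`, then so is a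
weakly compact operator into `c₀` on a subsequence: choose norming functionals `g n` for the images
`T (u n)`, extract a weak-* convergent subsequence by separability, and compose `T` with the
operator whose coordinates are the differences of the `g n` and their weak-* limit. -/
theorem exists_weaklyCompact_operator_czero {X Y : Type} [NormedAddCommGroup X] [NormedSpace ℝ X]
    [SeparableSpace X] [NormedAddCommGroup Y] [NormedSpace ℝ Y] {T : X →L[ℝ] Y}
    (hT : IsWeaklyCompactOperator T) {u : ℕ → X} (hu : WeaklyTendsto u 0) {δ : ℝ} (hδ : 0 < δ)
    (hTu : ∀ n, δ ≤ ‖T (u n)‖) :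
    ∃ S : X →L[ℝ] C₀(ℕ, ℝ), IsWeaklyCompactOperator S ∧
      ∃ φ : ℕ → ℕ, StrictMono φ ∧ ∀ k, δ / 2 ≤ ‖S (u (φ k))‖ := by
  -- The sequential Banach–Alaoglu theorem needs a separable range, so `T` is corestricted.
  let Z : Submodule ℝ Y := T.range.topologicalClosure
  let T' : X →L[ℝ] Z := T.codRestrict Z fun x => T.range.le_topologicalClosure ⟨x, rfl⟩
  have hT' : IsWeaklyCompactOperator T' := by
    refine IsRelativelyWeaklyCompact.of_image_subtype T.range.isClosed_topologicalClosure ?_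
    rw [← image_comp]
    exact hT
  have : SeparableSpace Z := (isSeparable_range T.continuous).closure.separableSpace
  have hnorm (n : ℕ) : ‖T' (u n)‖ = ‖T (u n)‖ := rfl
  choose g hg1 hg using fun n => exists_dual_vector ℝ (T' (u n))
    ((hδ.trans_le ((hTu n).trans_eq (hnorm n).symm)).ne')
  obtain ⟨a, -, φ, hφ, ha⟩ := WeakDual.isSeqCompact_closedBall ℝ Z 0 1
    (x := fun n => StrongDual.toWeakDual (g n)) fun n => by simp [hg1 n]
  let b : StrongDual ℝ Z := WeakDual.toStrongDual a
  have hb (z : Z) : Tendsto (fun k => g (φ k) z) atTop (𝓝 (b z)) :=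
    ((WeakDual.eval_continuous z).tendsto a).comp ha
  have hψC (k : ℕ) : ‖g (φ k) - b‖ ≤ 1 + ‖b‖ := (norm_sub_le _ _).trans_eq (by rw [hg1])
  have hψ (z : Z) : Tendsto (fun k => (g (φ k) - b) z) atTop (𝓝 0) := by
    simpa using (hb z).sub_const (b z)
  let R : Z →L[ℝ] C₀(ℕ, ℝ) := CZero.ofFunctionals (fun k => g (φ k) - b) hψC hψ
  have hbu : Tendsto (fun k => b (T' (u (φ k)))) atTop (𝓝 0) := by
    simpa using tendsto_toWeakSpace_iff.1 (hu.comp hφ.tendsto_atTop) (b.comp T')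
  obtain ⟨N, hN⟩ := eventually_atTop.1 (Metric.tendsto_nhds.1 hbu (δ / 2) (half_pos hδ))
  refine ⟨R.comp T', hT'.clm_comp R, fun k => φ (k + N), fun i j hij => hφ (by omega), fun k => ?_⟩
  have h1 := CZero.abs_apply_le_norm (R (T' (u (φ (k + N))))) (k + N)
  have h2 : R (T' (u (φ (k + N)))) (k + N) = ‖T (u (φ (k + N)))‖ - b (T' (u (φ (k + N)))) := by
    rw [CZero.ofFunctionals_apply, sub_apply, hg]
    rfl
  have h3 := hN (k + N) (by omega)
  rw [Real.dist_eq, sub_zero] at h3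
  have h4 := hTu (φ (k + N))
  rw [h2] at h1
  have h5 := le_abs_self (b (T' (u (φ (k + N)))))
  have h6 := le_abs_self (‖T (u (φ (k + N)))‖ - b (T' (u (φ (k + N)))))
  rw [ContinuousLinearMap.comp_apply]
  linarith

/-- In a space without the Dunford–Pettis property there is a contraction into `c₀` that is weakly
compact and does not tend to zero along some weakly null sequence of the unit ball. -/
theorem exists_operator_czero_of_not_hasDunfordPettis {X : Type} [NormedAddCommGroup X]
    [NormedSpace ℝ X] [SeparableSpace X] (hX : ¬ HasDunfordPettis X) :
    ∃ (S : X →L[ℝ] C₀(ℕ, ℝ)) (v : ℕ → X), IsWeaklyCompactOperator S ∧ ‖S‖ ≤ 1 ∧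
      (∀ n, ‖v n‖ ≤ 1) ∧ WeaklyTendsto v 0 ∧ ¬ Tendsto (fun n => S (v n)) atTop (𝓝 0) := by
  simp only [HasDunfordPettis, IsCompletelyContinuous] at hX
  push Not at hX
  obtain ⟨Y, _, _, _, T, hT, x, a, hx, hTx⟩ := hX
  have hu : WeaklyTendsto (fun n => x n - a) 0 :=
    tendsto_toWeakSpace_iff.2 fun f => by
      simpa using (tendsto_toWeakSpace_iff.1 hx f).sub_const (f a)
  obtain ⟨δ, hδ, hfreq⟩ : ∃ δ > 0, ∃ᶠ n in atTop, δ ≤ ‖T (x n - a)‖ := by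
    have h := hTx (T a)
    rw [Metric.tendsto_nhds] at h
    push Not at h
    obtain ⟨δ, hδ, h⟩ := h
    refine ⟨δ, hδ, h.mono fun n hn => ?_⟩
    simpa [dist_eq_norm] using hn
  obtain ⟨φ, hφ, hδφ⟩ := extraction_of_frequently_atTop hfreq
  obtain ⟨C, hC⟩ := hu.exists_norm_le
  obtain ⟨S, hS, ψ, hψ, hSψ⟩ := exists_weaklyCompact_operator_czero hT
    (hu.comp hφ.tendsto_atTop) hδ hδφ
  have hM : 0 < max C 1 := zero_lt_one.trans_le (le_max_right _ _)
  have hL : 0 < max ‖S‖ 1 := zero_lt_one.trans_le (le_max_right _ _)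
  refine ⟨(max ‖S‖ 1)⁻¹ • S, fun n => (max C 1)⁻¹ • (x (φ (ψ n)) - a), ?_, ?_, fun n => ?_, ?_, ?_⟩
  · have h : (max ‖S‖ 1)⁻¹ • S = ((max ‖S‖ 1)⁻¹ • ContinuousLinearMap.id ℝ C₀(ℕ, ℝ)).comp S := by
      ext; simp
    rw [h]
    exact hS.clm_comp _
  · refine ContinuousLinearMap.opNorm_le_bound _ zero_le_one fun w => ?_
    rw [smul_apply, norm_smul, norm_inv, Real.norm_of_nonneg hL.le, inv_mul_le_iff₀ hL, one_mul]
    exact S.le_of_opNorm_le (le_max_left _ _) w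
  · rw [norm_smul, norm_inv, Real.norm_of_nonneg hM.le]
    exact inv_mul_le_one_of_le₀ ((hC _).trans (le_max_left _ _)) hM.le
  · simpa using ((hu.comp hφ.tendsto_atTop).comp hψ.tendsto_atTop).map
      ((max C 1)⁻¹ • ContinuousLinearMap.id ℝ X)
  · intro h
    have h1 := ((h.const_smul (max ‖S‖ 1)).const_smul (max C 1)).norm
    simp only [smul_apply, map_smul, smul_inv_smul₀ hL.ne', smul_zero,
      smul_inv_smul₀ hM.ne', smul_comm _ (max C 1)⁻¹, norm_zero] at h1
    have h2 := ge_of_tendsto' h1 hSψ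
    linarith

/-- The witness of `exists_operator_czero_of_not_hasDunfordPettis` in the form of a dense sequence
of the unit ball whose odd-indexed terms are the weakly null sequence. -/
theorem exists_dense_seq_of_not_hasDunfordPettis {X : Type} [NormedAddCommGroup X]
    [NormedSpace ℝ X] [SeparableSpace X] (hX : ¬ HasDunfordPettis X) :
    ∃ (S : X →L[ℝ] C₀(ℕ, ℝ)) (x : ℕ → X), (∀ n, ‖x n‖ ≤ 1) ∧ (∀ n, ‖S (x n)‖ ≤ 1) ∧
      Metric.closedBall 0 1 ⊆ closure (range x) ∧
      IsRelativelyWeaklyCompact (range fun n => S (x n)) ∧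
      WeaklyTendsto (fun k => x (2 * k + 1)) 0 ∧
      ¬ Tendsto (fun k => S (x (2 * k + 1))) atTop (𝓝 0) := by
  obtain ⟨S, v, hS, hS1, hv1, hv, hSv⟩ := exists_operator_czero_of_not_hasDunfordPettis hX
  have : Nonempty (Metric.closedBall (0 : X) 1) := ⟨⟨0, by simp⟩⟩
  obtain ⟨d, hd⟩ := exists_dense_seq (Metric.closedBall (0 : X) 1)
  let x : ℕ → X := fun n => if Even n then d (n / 2) else v (n / 2)
  have hx1 (n : ℕ) : ‖x n‖ ≤ 1 := by
    by_cases hn : Even n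
    · simpa only [x, hn, if_true] using mem_closedBall_zero_iff.1 (d (n / 2)).2
    · simpa only [x, hn, if_false] using hv1 (n / 2)
  have hxe (k : ℕ) : x (2 * k) = d k := by simp [x]
  have hxo (k : ℕ) : x (2 * k + 1) = v k := by
    simp [x, show (2 * k + 1) / 2 = k by omega]
  refine ⟨S, x, hx1, fun n => (S.le_of_opNorm_le_of_le hS1 (hx1 n)).trans_eq (one_mul 1),
    fun w hw => ?_, ?_, ?_, ?_⟩
  · refine closure_mono ?_
      (image_closure_subset_closure_image continuous_subtype_val ⟨⟨w, hw⟩, hd _, rfl⟩)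
    rintro _ ⟨_, ⟨k, rfl⟩, rfl⟩
    exact ⟨2 * k, hxe k⟩
  · exact IsRelativelyWeaklyCompact.mono hS (range_subset_iff.2 fun n =>
      mem_image_of_mem _ (mem_closedBall_zero_iff.2 (hx1 n)))
  · simpa only [hxo] using hv
  · simpa only [hxo] using hSv

/-- Under the Dunford–Pettis property, an operator that is relatively weakly compact on a dense
sequence of the unit ball maps weakly null sequences to norm null sequences. -/
theorem HasDunfordPettis.tendsto_zero {X : Type u} [NormedAddCommGroup X] [NormedSpace ℝ X]
    (hX : HasDunfordPettis X) {Y : Type u} [NormedAddCommGroup Y] [NormedSpace ℝ Y]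
    [CompleteSpace Y] (S : X →L[ℝ] Y) {x : ℕ → X}
    (hx : Metric.closedBall 0 1 ⊆ closure (range x))
    (hS : IsRelativelyWeaklyCompact (range fun n => S (x n))) {u : ℕ → X}
    (hu : WeaklyTendsto u 0) : Tendsto (fun k => S (u k)) atTop (𝓝 0) := by
  have hS' : IsWeaklyCompactOperator S := by
    refine hS.closure.mono ((image_mono hx).trans ?_)
    refine (image_closure_subset_closure_image S.continuous).trans (closure_mono ?_)
    rw [← range_comp]
    rfl
  obtain ⟨b, hb⟩ := hX Y S hS' u 0 hu
  -- The norm limit `b` is also the weak limit, which is zero.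
  have hb0 : b = 0 := (SeparatingDual.eq_iff_forall_dual_eq (R := ℝ)).2 fun f => by
    have h := tendsto_toWeakSpace_iff.1 (hu.map S) f
    rw [map_zero] at h
    exact tendsto_nhds_unique ((f.continuous.tendsto b).comp hb) h
  exact hb0 ▸ hb

theorem SequenceCondition.hasDunfordPettis {X : SE} (h : SequenceCondition X) :
    HasDunfordPettis X.toSubmodule := by
  by_contra hX
  obtain ⟨S, x, hx1, hS1, hx, hS, hxo, hSo⟩ := exists_dense_seq_of_not_hasDunfordPettis hX
  rcases h (fun n => x n) (fun n => mem_closedBall_zero_iff.2 (hx1 n)) (fun n => S (x n))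
    (fun n => mem_closedBall_zero_iff.2 (hS1 n)) with h | h | h | h | h
  · refine h (Subset.antisymm ?_ (closure_minimal ?_ (X.isClosed.inter Metric.isClosed_closedBall)))
    · rintro w ⟨hwX, hw⟩
      have hw' : (⟨w, hwX⟩ : X.toSubmodule) ∈ closure (range x) :=
        hx (mem_closedBall_zero_iff.2 (mem_closedBall_zero_iff.1 hw))
      rw [closure_subtype, ← range_comp] at hw'
      exact hw'
    · rintro _ ⟨n, rfl⟩
      exact ⟨(x n).2, mem_closedBall_zero_iff.2 (hx1 n)⟩
  · have hle : closedSpan (fun n => (x n : CUnit)) ≤ X.toSubmodule :=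
      Submodule.topologicalClosure_minimal _
        (Submodule.span_le.2 (range_subset_iff.2 fun n => (x n).2)) X.isClosed
    exact h ⟨S.comp ((closedSpan _).subtypeL.codRestrict X.toSubmodule fun z => hle z.2),
      fun n => rfl⟩
  · exact h hS
  · exact h (hxo.map X.toSubmodule.subtypeL)
  · exact hSo h

theorem HasDunfordPettis.sequenceCondition {X : SE} (hX : HasDunfordPettis X.toSubmodule) :
    SequenceCondition X := by
  intro x _ y _
  by_contra! h
  obtain ⟨hcl, ⟨T, hT⟩, hrel, hweak, hy⟩ := h
  have hcs : closure (range x) ⊆ closedSpan x := closure_mono Submodule.subset_span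
  have hxX (n : ℕ) : x n ∈ X.toSubmodule :=
    (hcl.superset (subset_closure (mem_range_self n))).1
  have hle : X.toSubmodule ≤ closedSpan x := fun w hw => by
    rcases eq_or_ne w 0 with rfl | hw0
    · exact Submodule.zero_mem _
    · rw [← Submodule.smul_mem_iff _ (inv_ne_zero (norm_ne_zero_iff.2 hw0))]
      refine hcs (hcl.subset ⟨X.toSubmodule.smul_mem _ hw, ?_⟩)
      rw [mem_closedBall_zero_iff, norm_smul, norm_inv, norm_norm,
        inv_mul_cancel₀ (norm_ne_zero_iff.2 hw0)]
  let S : X.toSubmodule →L[ℝ] C₀(ℕ, ℝ) :=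
    T.comp (X.toSubmodule.subtypeL.codRestrict (closedSpan x) fun w => hle w.2)
  let x' : ℕ → X.toSubmodule := fun n => ⟨x n, hxX n⟩
  have hSx : (fun n => S (x' n)) = y := funext hT
  have hx : Metric.closedBall 0 1 ⊆ closure (range x') := fun w hw => by
    rw [closure_subtype, ← range_comp]
    exact hcl.subset ⟨w.2, mem_closedBall_zero_iff.2 (mem_closedBall_zero_iff.1 hw)⟩
  have hweak' : WeaklyTendsto (fun k => x' (2 * k + 1)) 0 :=
    (isInducing_weakSpace_map_subtypeL X.toSubmodule).tendsto_nhds_iff.2 hweak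
  have h := hX.tendsto_zero S hx (by rw [hSx]; exact hrel) hweak'
  exact hy (h.congr fun k => congrFun hSx (2 * k + 1))

theorem hasDunfordPettis_iff_sequenceCondition (X : SE) :
    HasDunfordPettis X.toSubmodule ↔ SequenceCondition X :=
  ⟨HasDunfordPettis.sequenceCondition, SequenceCondition.hasDunfordPettis⟩

end DunfordPettis

/-! ### Measurability of the sequence condition -/

section Measurability

noncomputable instance : MeasurableSpace CUnit := borel CUnit
instance : BorelSpace CUnit := ⟨rfl⟩
noncomputable instance : MeasurableSpace C₀(ℕ, ℝ) := borel C₀(ℕ, ℝ)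
instance : BorelSpace C₀(ℕ, ℝ) := ⟨rfl⟩

theorem SE.measurableSet_inter_nonempty {U : Set CUnit} (hU : IsOpen U) :
    MeasurableSet {X : SE | ((X : Set CUnit) ∩ U).Nonempty} :=
  ⟨_, MeasurableSpace.measurableSet_generateFrom ⟨U, hU, rfl⟩, rfl⟩

theorem measurableSet_mem_closure_range {E : Type*} [TopologicalSpace E] [SecondCountableTopology E]
    [MeasurableSpace E] [BorelSpace E] :
    MeasurableSet {p : (ℕ → E) × E | p.2 ∈ closure (range p.1)} := by
  simp only [(isBasis_countableBasis E).mem_closure_iff, Set.inter_nonempty]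
  refine .congr (s := ⋂ o ∈ countableBasis E, ({p | p.2 ∈ o}ᶜ ∪ ⋃ n, {p | p.1 n ∈ o})) ?_ ?_
  · refine .biInter (countable_countableBasis E) fun o ho => ?_
    have ho' := (isOpen_of_mem_countableBasis ho).measurableSet
    exact .union (measurable_snd ho').compl
      (.iUnion fun n => ((measurable_pi_apply n).comp measurable_fst) ho')
  · ext p
    simp [imp_iff_not_or]

theorem SE.measurableSet_mem : MeasurableSet {p : SE × CUnit | p.2 ∈ p.1} := by
  refine .congr (s := ⋂ o ∈ countableBasis CUnit,
    ({p : SE × CUnit | p.2 ∈ o}ᶜ ∪ {p | ((p.1 : Set CUnit) ∩ o).Nonempty})) ?_ ?_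
  · refine .biInter (countable_countableBasis _) fun o ho => ?_
    have ho' := isOpen_of_mem_countableBasis ho
    exact .union (measurable_snd ho'.measurableSet).compl
      (measurable_fst (SE.measurableSet_inter_nonempty ho'))
  · ext p
    have h := (isBasis_countableBasis CUnit).mem_closure_iff (s := (p.1 : Set CUnit)) (a := p.2)
    rw [p.1.isClosed.closure_eq, SetLike.mem_coe] at h
    simp [h, imp_iff_not_or, inter_comm]

/-- For a closed subspace `X`, the unit ball of `X` is the closure of the open unit ball, so that
only intersections of `X` with open sets enter. -/
theorem SE.inter_closedBall_subset_closure_iff (X : SE) (S : Set CUnit) :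
    (X : Set CUnit) ∩ Metric.closedBall 0 1 ⊆ closure S ↔
      ∀ o ∈ countableBasis CUnit, ((X : Set CUnit) ∩ (Metric.ball 0 1 ∩ o)).Nonempty →
        (o ∩ S).Nonempty := by
  constructor
  · rintro h o ho ⟨w, hwX, hw, hwo⟩
    exact (isBasis_countableBasis CUnit).mem_closure_iff.1
      (h ⟨hwX, Metric.ball_subset_closedBall hw⟩) o ho hwo
  · rintro h w ⟨hwX, hw⟩
    have hball : (X : Set CUnit) ∩ Metric.ball 0 1 ⊆ closure S := fun z hz =>
      (isBasis_countableBasis CUnit).mem_closure_iff.2 fun o ho hzo => h o ho ⟨z, hz.1, hz.2, hzo⟩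
    -- Approximate `w` by its multiples `t • w` with `0 < t < 1`.
    have ht : Tendsto (fun t : ℝ => t • w) (𝓝[<] 1) (𝓝 w) := by
      have h : Continuous fun t : ℝ => t • w := by fun_prop
      simpa using (h.tendsto 1).mono_left nhdsWithin_le_nhds
    refine isClosed_closure.mem_of_tendsto ht ?_
    filter_upwards [Ioo_mem_nhdsLT (zero_lt_one (α := ℝ))] with t ht
    refine hball ⟨X.toSubmodule.smul_mem _ hwX, ?_⟩
    rw [mem_ball_zero_iff, norm_smul, Real.norm_of_nonneg ht.1.le]
    rw [mem_closedBall_zero_iff] at hw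
    exact (mul_le_of_le_one_right ht.1.le hw).trans_lt ht.2

theorem SE.measurableSet_unitBall_eq_closure_range :
    MeasurableSet {p : SE × (ℕ → CUnit) |
      (p.1 : Set CUnit) ∩ Metric.closedBall 0 1 = closure (range p.2)} := by
  refine .congr (s := (⋂ o ∈ countableBasis CUnit,
      ({p : SE × (ℕ → CUnit) | ((p.1 : Set CUnit) ∩ (Metric.ball 0 1 ∩ o)).Nonempty}ᶜ ∪
        ⋃ n, {p | p.2 n ∈ o})) ∩
    ⋂ n, {p | p.2 n ∈ p.1} ∩ {p | p.2 n ∈ Metric.closedBall 0 1}) ?_ ?_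
  · refine .inter (.biInter (countable_countableBasis _) fun o ho => ?_) (.iInter fun n => ?_)
    · have ho' := isOpen_of_mem_countableBasis ho
      exact .union (measurable_fst
        (SE.measurableSet_inter_nonempty (Metric.isOpen_ball.inter ho'))).compl
        (.iUnion fun n => ((measurable_pi_apply n).comp measurable_snd) ho'.measurableSet)
    · have hn : Measurable fun p : SE × (ℕ → CUnit) => p.2 n :=
        (measurable_pi_apply n).comp measurable_snd
      exact .inter ((measurable_fst.prodMk hn) SE.measurableSet_mem)
        (hn Metric.isClosed_closedBall.measurableSet)
  · ext p
    have h1 : closure (range p.2) ⊆ (p.1 : Set CUnit) ∩ Metric.closedBall 0 1 ↔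
        ∀ n, p.2 n ∈ p.1 ∧ p.2 n ∈ Metric.closedBall (0 : CUnit) 1 := by
      rw [(p.1.isClosed.inter Metric.isClosed_closedBall).closure_subset_iff, range_subset_iff]
      rfl
    rw [mem_ofPred_eq, subset_antisymm_iff, h1, SE.inter_closedBall_subset_closure_iff]
    simp [imp_iff_not_or, Set.inter_nonempty]

/-- The pairs `(x, y)` of sequences such that `x n ↦ y n` extends to a bounded linear operator on
the closed linear span of the `x n` form a Borel set: it suffices to bound the rational linear
combinations. -/
theorem measurableSet_exists_clm {E F : Type*} [NormedAddCommGroup E] [NormedSpace ℝ E]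
    [SecondCountableTopology E] [MeasurableSpace E] [BorelSpace E]
    [NormedAddCommGroup F] [NormedSpace ℝ F] [CompleteSpace F]
    [SecondCountableTopology F] [MeasurableSpace F] [BorelSpace F] :
    MeasurableSet {p : (ℕ → E) × (ℕ → F) |
      ∃ T : (Submodule.span ℝ (range p.1)).topologicalClosure →L[ℝ] F,
        ∀ n, T ⟨p.1 n, Submodule.le_topologicalClosure _
          (Submodule.subset_span (mem_range_self n))⟩ = p.2 n} := by
  simp only [exists_clm_closure_span_iff, ofPred_exists, ofPred_forall]
  refine .iUnion fun K => .iInter fun s => .iInter fun c => measurableSet_le ?_ ?_ <;> fun_prop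

/-- By the Hahn–Banach theorem, weak convergence to zero of a subsequence of `x` can be tested
on the sequences `z` of values that functionals take on `x`. -/
theorem weaklyTendsto_comp_zero_iff (x : ℕ → CUnit) (φ : ℕ → ℕ) :
    WeaklyTendsto (fun k => x (φ k)) 0 ↔ ∀ z : ℕ → ℝ,
      (∃ T : closedSpan x →L[ℝ] ℝ, ∀ n, T ⟨x n, mem_closedSpan x n⟩ = z n) →
        Tendsto (fun k => z (φ k)) atTop (𝓝 0) := by
  refine tendsto_toWeakSpace_iff.trans ⟨fun h z ⟨T, hT⟩ => ?_, fun h f => ?_⟩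
  · obtain ⟨g, hg, -⟩ := exists_extension_norm_eq _ T
    have h' := h g
    simp only [map_zero] at h'
    refine h'.congr fun k => ?_
    rw [← hT]
    exact hg ⟨x (φ k), mem_closedSpan x _⟩
  · rw [map_zero]
    exact h (fun n => f (x n)) ⟨f.comp (closedSpan x).subtypeL, fun n => rfl⟩

/-- The negation of `SequenceCondition` is a projection along the pairs `(x, y)`. The two conditions
on `(x, y)` that are not Borel, weak nullity in `C([0, 1])` and relative weak compactness in `c₀`,
both quantify universally over one real sequence, so their conjunction is a single `Π¹₁`
condition. -/
theorem isSigma12_setOf_not_sequenceCondition : IsSigma12 {X : SE | ¬ SequenceCondition X} := by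
  -- `Q` collects the Borel conditions, and `P` those that are tested on all real sequences `z`.
  let Q : Set (SE × (ℕ → CUnit) × (ℕ → C₀(ℕ, ℝ))) := {p | (∀ n, ‖p.2.1 n‖ ≤ 1) ∧
    (∀ n, ‖p.2.2 n‖ ≤ 1) ∧ (p.1 : Set CUnit) ∩ Metric.closedBall 0 1 = closure (range p.2.1) ∧
    DefinesBoundedOperator p.2.1 p.2.2 ∧ ¬ Tendsto (fun k => p.2.2 (2 * k + 1)) atTop (𝓝 0)}
  let P : Set ((SE × (ℕ → CUnit) × (ℕ → C₀(ℕ, ℝ))) × (ℕ → ℝ)) := {q |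
    (q.2 ∈ closure (range fun n i => q.1.2.2 n i) → Tendsto q.2 atTop (𝓝 0)) ∧
    ((∃ T : closedSpan q.1.2.1 →L[ℝ] ℝ, ∀ n, T ⟨q.1.2.1 n, mem_closedSpan _ n⟩ = q.2 n) →
      Tendsto (fun k => q.2 (2 * k + 1)) atTop (𝓝 0))}
  have hx (n : ℕ) : Measurable fun p : SE × (ℕ → CUnit) × (ℕ → C₀(ℕ, ℝ)) => p.2.1 n :=
    (measurable_pi_apply n).comp (measurable_fst.comp measurable_snd)
  have hy (n : ℕ) : Measurable fun p : SE × (ℕ → CUnit) × (ℕ → C₀(ℕ, ℝ)) => p.2.2 n :=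
    (measurable_pi_apply n).comp (measurable_snd.comp measurable_snd)
  have hz (n : ℕ) : Measurable
      fun q : (SE × (ℕ → CUnit) × (ℕ → C₀(ℕ, ℝ))) × (ℕ → ℝ) => q.2 n :=
    (measurable_pi_apply n).comp measurable_snd
  have hQ : MeasurableSet Q := by
    refine .inter ?_ (.inter ?_ (.inter ?_ (.inter ?_ (.compl ?_))))
    · change MeasurableSet {p : SE × (ℕ → CUnit) × (ℕ → C₀(ℕ, ℝ)) | ∀ n, ‖p.2.1 n‖ ≤ 1}
      rw [ofPred_forall]
      exact .iInter fun n => measurableSet_le (hx n).norm measurable_const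
    · change MeasurableSet {p : SE × (ℕ → CUnit) × (ℕ → C₀(ℕ, ℝ)) | ∀ n, ‖p.2.2 n‖ ≤ 1}
      rw [ofPred_forall]
      exact .iInter fun n => measurableSet_le (hy n).norm measurable_const
    · exact (measurable_fst.prodMk (measurable_fst.comp measurable_snd))
        SE.measurableSet_unitBall_eq_closure_range
    · exact measurable_snd measurableSet_exists_clm
    · exact measurableSet_tendsto _ fun k => hy (2 * k + 1)
  have hP : MeasurableSet P := by
    have hcl : MeasurableSet {q : (SE × (ℕ → CUnit) × (ℕ → C₀(ℕ, ℝ))) × (ℕ → ℝ) |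
        q.2 ∈ closure (range fun n i => q.1.2.2 n i)} := by
      have h : Measurable fun q : (SE × (ℕ → CUnit) × (ℕ → C₀(ℕ, ℝ))) × (ℕ → ℝ) =>
          ((fun n i => q.1.2.2 n i : ℕ → ℕ → ℝ), q.2) :=
        (measurable_pi_lambda _ fun n => CZero.continuous_coe.measurable.comp
          ((hy n).comp measurable_fst)).prodMk measurable_snd
      exact h measurableSet_mem_closure_range
    have hext : MeasurableSet {q : (SE × (ℕ → CUnit) × (ℕ → C₀(ℕ, ℝ))) × (ℕ → ℝ) |
        ∃ T : closedSpan q.1.2.1 →L[ℝ] ℝ, ∀ n, T ⟨q.1.2.1 n, mem_closedSpan _ n⟩ = q.2 n} :=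
      ((measurable_fst.comp (measurable_snd.comp measurable_fst)).prodMk measurable_snd)
        measurableSet_exists_clm
    exact .inter (hcl.imp (measurableSet_tendsto _ hz))
      (hext.imp (measurableSet_tendsto _ fun k => hz (2 * k + 1)))
  refine ⟨(ℕ → CUnit) × (ℕ → C₀(ℕ, ℝ)), inferInstance, inferInstance,
    {p | p ∈ Q ∧ ∀ z, (p, z) ∈ P},
    ⟨ℕ → ℝ, inferInstance, inferInstance, {q | ¬ (q.1 ∈ Q ∧ q ∈ P)}, ?_, ?_⟩, ?_⟩
  · exact ((measurable_fst hQ).inter hP).compl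
  · ext p
    constructor
    · intro hp
      by_contra h
      have h' (z : ℕ → ℝ) : p ∈ Q ∧ (p, z) ∈ P := by
        by_contra hz
        exact h ⟨(p, z), hz, rfl⟩
      exact hp ⟨(h' 0).1, fun z => (h' z).2⟩
    · rintro ⟨⟨p, z⟩, hz, rfl⟩ ⟨hp, hp'⟩
      exact hz ⟨hp, hp' z⟩
  · have key (p : SE × (ℕ → CUnit) × (ℕ → C₀(ℕ, ℝ))) (hp : ∀ n, ‖p.2.2 n‖ ≤ 1) :
        (∀ z, (p, z) ∈ P) ↔ IsRelativelyWeaklyCompact (range p.2.2) ∧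
          WeaklyTendsto (fun k => p.2.1 (2 * k + 1)) 0 := by
      rw [weaklyTendsto_comp_zero_iff p.2.1 fun k => 2 * k + 1,
        CZero.isRelativelyWeaklyCompact_iff (forall_mem_range.2 hp), ← range_comp, ← forall_and]
      rfl
    ext X
    constructor
    · intro hX
      simp only [SequenceCondition, mem_ofPred_eq] at hX
      push Not at hX
      obtain ⟨x, hx, y, hy, h1, h2, h3, h4, h5⟩ := hX
      simp only [mem_closedBall_zero_iff] at hx hy
      exact ⟨(X, x, y), ⟨⟨hx, hy, h1, h2, h5⟩, (key (X, x, y) hy).2 ⟨h3, h4⟩⟩, rfl⟩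
    · rintro ⟨⟨X, x, y⟩, ⟨⟨hx, hy, h1, h2, h5⟩, hP⟩, rfl⟩ h
      obtain ⟨h3, h4⟩ := (key (X, x, y) hy).1 hP
      rcases h x (fun n => mem_closedBall_zero_iff.2 (hx n)) y
        (fun n => mem_closedBall_zero_iff.2 (hy n)) with h | h | h | h | h
      exacts [h h1, h h2, h h3, h h4, h5 h]

end Measurability

theorem mainTheorem8 :
    IsPi12 {X : SE | HasDunfordPettis X.toSubmodule} ∧
      ∀ X : SE, HasDunfordPettis X.toSubmodule ↔ SequenceCondition X := by
  refine ⟨?_, hasDunfordPettis_iff_sequenceCondition⟩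
  simp only [hasDunfordPettis_iff_sequenceCondition]
  exact isSigma12_setOf_not_sequenceCondition
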